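/- For an entire function $f$ and $r>0$ write $M(r,f)=\max_{|z|=r}|f(z)|$. An entire function is transcendental if it is not a polynomial. A transcendental entire function $f$ is strongly log-regular if for every $\varepsilon\in(0,1)$ there exist $R>0$ and $k>1$ such that $$\log M(r^k,f)\ \geq\ \bigl(k\log M(r,f)\bigr)^{1/\varepsilon}\qquad\text{for all } r>R.$$ Theorem. Let $j\geq 1$, let $f_1,f_2,\dots,f_j$ be transcendental entire functions, and suppose that $f_1$ is strongly log-regular. Then $f_1\circ f_2\circ\cdots\circ f_j$ is strongly log-regular (in particular, transcendental entire). Consequently, if $f$ is strongly log-regular, then its $n$-th iterate $f^n$ is strongly log-regular for every $n\geq 1$. -/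

import Mathlib

/-- The maximum modulus `M(r, f) = max_{|z| = r} |f z|`. For entire `f` and `r ≥ 0` the supremum is
taken over the nonempty compact circle `|z| = r`, so it is attained. -/
noncomputable def maxModulus (f : ℂ → ℂ) (r : ℝ) : ℝ :=
  sSup ((fun z => ‖f z‖) '' Metric.sphere (0 : ℂ) r)

/-- A transcendental entire function: holomorphic on the whole plane and not a polynomial. -/
def IsTranscendentalEntire (f : ℂ → ℂ) : Prop :=
  Differentiable ℂ f ∧ ¬ ∃ p : Polynomial ℂ, ∀ z : ℂ, f z = p.eval z

/-- A transcendental entire function `f` is strongly log-regular if for every `ε ∈ (0, 1)` there are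
`R > 0` and `k > 1` such that `log M(r ^ k) ≥ (k log M(r)) ^ (1 / ε)` for all `r > R`.
(Enlarging `R` preserves the inequality, so only radii with `log M(r) > 0` matter.) -/
def IsStronglyLogRegular (f : ℂ → ℂ) : Prop :=
  IsTranscendentalEntire f ∧
    ∀ ε : ℝ, 0 < ε → ε < 1 → ∃ R k : ℝ, 0 < R ∧ 1 < k ∧ ∀ r : ℝ, R < r →
      (k * Real.log (maxModulus f r)) ^ (1 / ε) ≤ Real.log (maxModulus f (r ^ k))

/-- The composition `f 0 ∘ f 1 ∘ ⋯ ∘ f (j - 1)`. -/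
def finComp {j : ℕ} (f : Fin j → ℂ → ℂ) : ℂ → ℂ :=
  (List.ofFn f).foldr (fun g h => g ∘ h) id

/-! It suffices to compose a strongly log-regular `f` with one inner function `g`. Put X = log
M(M(r,g), f). The maximum principle gives log M(r, f∘g) ≤ X. Conversely, g maps the disc of radius
r^(k+2) onto a set containing a circle of radius at least M(r,g)^k, so M(M(r,g)^k, f) ≤ M(r^(k+2),
f∘g) (`eventually_maxModulus_le_maxModulus_comp`). Regularity of f at radius M(r,g) then bounds log
M(r^(k+2), f∘g) below by a power of X. The circle comes from Bohr's theorem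
(`exists_sphere_subset_image`), proved via Bloch and Schottky, with Hadamard's three circles theorem
supplying a large value of g. -/

/-! ### Theorems of Bloch, Schottky and Bohr -/

theorem exists_exp_eq_of_ne_zero {g : ℂ → ℂ} {c : ℂ} {R : ℝ}
    (hg : DifferentiableOn ℂ g (Metric.ball c R)) (h0 : ∀ z ∈ Metric.ball c R, g z ≠ 0) :
    ∃ L : ℂ → ℂ, DifferentiableOn ℂ L (Metric.ball c R) ∧ L c = Complex.log (g c) ∧
      ∀ z ∈ Metric.ball c R, Complex.exp (L z) = g z := by
  have hq : DifferentiableOn ℂ (fun z => deriv g z / g z) (Metric.ball c R) :=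
    (hg.deriv Metric.isOpen_ball).div hg h0
  -- The principal value at the centre is what later bounds the logarithm there.
  obtain ⟨L, hLc, hL⟩ := hq.isExactOn_ball.with_val_at c (Complex.log (g c))
  refine ⟨L, fun z hz => (hL z hz).differentiableAt.differentiableWithinAt, hLc, fun z hz => ?_⟩
  have hR : 0 < R := Metric.pos_of_mem_ball hz
  have hcst : ∀ w ∈ Metric.ball c R, HasDerivAt (fun w => g w * Complex.exp (-L w)) 0 w := by
    intro w hw
    have h1 := (hg.differentiableAt (Metric.isOpen_ball.mem_nhds hw)).hasDerivAt
    convert! h1.mul (hL w hw).neg.cexp using 1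
    have := h0 w hw
    field_simp
    ring
  have hconst : g z * Complex.exp (-L z) = g c * Complex.exp (-L c) := by
    refine Metric.isOpen_ball.is_const_of_deriv_eq_zero (convex_ball c R).isPreconnected
      (fun w hw => (hcst w hw).differentiableAt.differentiableWithinAt)
      (fun w hw => (hcst w hw).deriv) hz (Metric.mem_ball_self hR)
  rw [hLc, Complex.exp_neg, Complex.exp_neg, Complex.exp_log (h0 c (Metric.mem_ball_self hR)),
    mul_inv_cancel₀ (h0 c (Metric.mem_ball_self hR))] at hconst
  field_simp at hconst
  exact hconst.symm

/-- With a holomorphic root of F² - 1, the factors F ± √(F² - 1) have product 1, so F + √(F² - 1)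
has a logarithm H. -/
theorem exists_cosh_eq_of_sq_ne_one {F : ℂ → ℂ} {c : ℂ} {R : ℝ}
    (hF : DifferentiableOn ℂ F (Metric.ball c R)) (h1 : ∀ z ∈ Metric.ball c R, F z ^ 2 ≠ 1) :
    ∃ H : ℂ → ℂ, DifferentiableOn ℂ H (Metric.ball c R) ∧
      ∀ z ∈ Metric.ball c R, Complex.cosh (H z) = F z := by
  obtain ⟨L, hL, -, hLe⟩ := exists_exp_eq_of_ne_zero (g := fun z => F z ^ 2 - 1)
    ((hF.pow 2).sub_const 1) (fun z hz => sub_ne_zero.2 (h1 z hz))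
  have hq : ∀ z ∈ Metric.ball c R, Complex.exp (L z / 2) ^ 2 = F z ^ 2 - 1 := by
    intro z hz
    rw [← hLe z hz, ← Complex.exp_nat_mul]
    congr 1
    push_cast
    ring
  have hp : ∀ z ∈ Metric.ball c R,
      (F z + Complex.exp (L z / 2)) * (F z - Complex.exp (L z / 2)) = 1 := by
    intro z hz
    linear_combination - hq z hz
  obtain ⟨H, hH, -, hHe⟩ := exists_exp_eq_of_ne_zero (g := fun z => F z + Complex.exp (L z / 2))
    (hF.add (hL.div_const 2).cexp) (fun z hz => left_ne_zero_of_mul (hp z hz ▸ one_ne_zero))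
  refine ⟨H, hH, fun z hz => ?_⟩
  have hinv : Complex.exp (-H z) = F z - Complex.exp (L z / 2) := by
    rw [Complex.exp_neg, hHe z hz]
    exact inv_eq_of_mul_eq_one_right (hp z hz)
  rw [Complex.cosh, hinv, hHe z hz]
  ring

/-- **Bloch's theorem**: the image of a holomorphic function contains a disc whose radius is
proportional to the derivative at the centre. -/
theorem exists_ball_subset_image_of_deriv {H : ℂ → ℂ} {a : ℂ} {ρ R : ℝ} (hρ : 0 < ρ) (hρR : ρ < R)
    (hH : DifferentiableOn ℂ H (Metric.ball a R)) :
    ∃ w, Metric.ball w (ρ * ‖deriv H a‖ / 64) ⊆ H '' Metric.ball a R := by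
  rcases eq_or_ne (deriv H a) 0 with h0 | h0
  · exact ⟨0, by simp [h0]⟩
  have hd := hH.deriv Metric.isOpen_ball
  have hsub : Metric.closedBall a ρ ⊆ Metric.ball a R := Metric.closedBall_subset_ball hρR
  have hcont : ContinuousOn (fun z => (ρ - ‖z - a‖) * ‖deriv H z‖) (Metric.closedBall a ρ) :=
    ContinuousOn.mul (by fun_prop) (hd.continuousOn.mono hsub).norm
  -- At a maximiser p of (ρ - |z - a|)|H'(z)|, the derivative at most doubles on the disc about p of
  -- half the remaining radius.
  obtain ⟨p, hp, hmax⟩ := (isCompact_closedBall a ρ).exists_isMaxOn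
    ⟨a, Metric.mem_closedBall_self hρ.le⟩ hcont
  have hmax' : ∀ z, ‖z - a‖ ≤ ρ → (ρ - ‖z - a‖) * ‖deriv H z‖ ≤ (ρ - ‖p - a‖) * ‖deriv H p‖ :=
    fun z hz => hmax (mem_closedBall_iff_norm.2 hz)
  have hpa : ρ * ‖deriv H a‖ ≤ (ρ - ‖p - a‖) * ‖deriv H p‖ := by
    simpa using hmax' a (by simpa using hρ.le)
  have hpρ : ‖p - a‖ ≤ ρ := mem_closedBall_iff_norm.1 hp
  have hpos : 0 < (ρ - ‖p - a‖) * ‖deriv H p‖ :=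
    lt_of_lt_of_le (mul_pos hρ (norm_pos_iff.2 h0)) hpa
  set m := ‖deriv H p‖ with hm
  have hm0 : 0 < m := pos_of_mul_pos_right hpos (sub_nonneg.2 hpρ)
  have ht0' : 0 < ρ - ‖p - a‖ := pos_of_mul_pos_left hpos hm0.le
  obtain ⟨t, ht⟩ : ∃ t, t = (ρ - ‖p - a‖) / 2 := ⟨_, rfl⟩
  have ht0 : 0 < t := by rw [ht]; positivity
  have htri : ∀ z, ‖z - a‖ ≤ ‖z - p‖ + ‖p - a‖ := fun z => norm_sub_le_norm_sub_add_norm_sub z p a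
  have hballsub : Metric.ball p t ⊆ Metric.ball a R := by
    intro z hz
    rw [mem_ball_iff_norm] at hz ⊢
    linarith [htri z]
  have hderiv : ∀ z ∈ Metric.ball p t, ‖deriv H z‖ ≤ 2 * m := by
    intro z hz
    rw [mem_ball_iff_norm] at hz
    have h1 := hmax' z (by linarith [htri z])
    have h2 : t * ‖deriv H z‖ ≤ t * (2 * m) := by
      calc t * ‖deriv H z‖ ≤ (ρ - ‖z - a‖) * ‖deriv H z‖ := by
            gcongr
            linarith [htri z]
        _ ≤ _ := h1
        _ = t * (2 * m) := by rw [ht]; ring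
    exact le_of_mul_le_mul_left h2 ht0
  have hsch : ∀ z ∈ Metric.ball p t, ‖deriv H z - deriv H p‖ ≤ 4 * m / t * ‖z - p‖ := by
    intro z hz
    have := Complex.dist_le_div_mul_dist_of_mapsTo_ball (f := deriv H) (R₂ := 4 * m)
      (hd.mono hballsub) (fun w hw => by
        rw [mem_closedBall_iff_norm]
        have := norm_sub_le (deriv H w) (deriv H p)
        linarith [hderiv w hw]) hz
    simpa only [dist_eq_norm] using this
  -- With s = t/8 the Schwarz bound 4m/t · s equals m/2, so the linear part of H dominates on |z -
  -- p| = s.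
  obtain ⟨s, hs⟩ : ∃ s, s = t / 8 := ⟨_, rfl⟩
  have hs0 : 0 < s := by rw [hs]; positivity
  have hcs : Metric.closedBall p s ⊆ Metric.ball p t :=
    Metric.closedBall_subset_ball (by linarith)
  have hHat : ∀ z ∈ Metric.ball p t, DifferentiableAt ℂ H z := fun z hz =>
    hH.differentiableAt (Metric.isOpen_ball.mem_nhds (hballsub hz))
  have hmv : ∀ z ∈ Metric.closedBall p s, ‖H z - H p - deriv H p * (z - p)‖ ≤ m / 2 * ‖z - p‖ := by
    intro z hz
    have := Convex.norm_image_sub_le_of_norm_hasDerivWithin_le (𝕜 := ℂ)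
      (f := fun z => H z - deriv H p * z) (f' := fun z => deriv H z - deriv H p * 1) (C := m / 2)
      (s := Metric.closedBall p s) (x := p) (y := z)
      (fun w hw => ((hHat w (hcs hw)).hasDerivAt.sub
        ((hasDerivAt_id w).const_mul _)).hasDerivWithinAt)
      (fun w hw => by
        have h1 := hsch w (hcs hw)
        rw [mem_closedBall_iff_norm] at hw
        rw [mul_one]
        calc _ ≤ 4 * m / t * ‖w - p‖ := h1
          _ ≤ 4 * m / t * s := by gcongr
          _ = m / 2 := by rw [hs]; field_simp; norm_num)
      (convex_closedBall p s) (Metric.mem_closedBall_self hs0.le) hz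
    refine le_trans (le_of_eq ?_) this
    congr 1
    ring
  have hsphere : ∀ z ∈ Metric.sphere p s, m * s / 2 ≤ ‖H z - H p‖ := by
    intro z hz
    have h1 := hmv z (Metric.sphere_subset_closedBall hz)
    rw [mem_sphere_iff_norm] at hz
    have h2 : ‖deriv H p * (z - p)‖ = m * s := by rw [norm_mul, hz]
    have h3 := norm_sub_norm_le (deriv H p * (z - p)) (H z - H p)
    rw [norm_sub_rev (deriv H p * (z - p))] at h3
    rw [hz] at h1
    linarith
  have hfreq : ∃ᶠ z in nhds p, H z ≠ H p := by
    intro hev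
    have hev' : H =ᶠ[nhds p] fun _ => H p := by
      filter_upwards [hev] with z hz using not_not.1 hz
    have : deriv H p = 0 := by rw [hev'.deriv_eq, deriv_const]
    rw [hm, this, norm_zero] at hm0
    exact lt_irrefl _ hm0
  have hdc : DiffContOnCl ℂ H (Metric.ball p s) := by
    refine DifferentiableOn.diffContOnCl fun z hz => ?_
    rw [closure_ball p hs0.ne'] at hz
    exact (hHat z (hcs hz)).differentiableWithinAt
  have := hdc.ball_subset_image_closedBall hs0 hsphere hfreq
  refine ⟨H p, (Metric.ball_subset_ball ?_).trans (this.trans (Set.image_mono (hcs.trans hballsub)))⟩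
  rw [hs, ht]
  nlinarith

theorem exists_cosh_eq_natCast_abs_sub_le {x : ℝ} (hx : 0 ≤ x) :
    ∃ (t : ℝ) (n : ℕ), Real.cosh t = n ∧ |x - t| ≤ 2 := by
  have hc : 1 ≤ Real.cosh x := Real.one_le_cosh x
  have hn1 : 1 ≤ ⌊Real.cosh x⌋₊ := Nat.le_floor (by simp)
  have hn1' : (1 : ℝ) ≤ ⌊Real.cosh x⌋₊ := by exact_mod_cast hn1
  have hle : (⌊Real.cosh x⌋₊ : ℝ) ≤ Real.cosh x := Nat.floor_le (by linarith)
  have hlt : Real.cosh x < ⌊Real.cosh x⌋₊ + 1 := Nat.lt_floor_add_one _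
  set n := ⌊Real.cosh x⌋₊
  have hcosh := Real.cosh_arcosh hn1'
  have ht := Real.arcosh_nonneg hn1'
  refine ⟨Real.arcosh n, n, hcosh, ?_⟩
  have h1 : Real.arcosh n ≤ x := by
    rw [← Real.arcosh_cosh hx]
    exact (Real.arcosh_le_arcosh (by linarith) (by linarith)).2 hle
  rw [abs_of_nonneg (by linarith)]
  by_contra! hcon
  -- Since cosh 2 ≥ 2, cosh (arcosh n + 2) ≥ 2n ≥ n + 1 > cosh x, a contradiction.
  have h2 : Real.cosh (Real.arcosh n + 2) ≤ Real.cosh x := by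
    rw [Real.cosh_le_cosh, abs_of_nonneg (by linarith), abs_of_nonneg hx]
    linarith
  have h3 : 2 ≤ Real.cosh 2 := by
    have := Real.self_le_sinh_iff.2 (show (0:ℝ) ≤ 2 by norm_num)
    linarith [Real.sinh_lt_cosh 2]
  have h4 : 0 ≤ Real.sinh (Real.arcosh n) * Real.sinh 2 :=
    mul_nonneg (Real.sinh_nonneg_iff.2 ht) (Real.sinh_nonneg_iff.2 (by norm_num))
  rw [Real.cosh_add, hcosh] at h2
  nlinarith

/-- If cosh ∘ H omits the integers, the image of H contains no disc of radius 6. The constant comes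
from 2 + π < 6. -/
theorem exists_cosh_eq_intCast_norm_sub_lt (z : ℂ) :
    ∃ (a : ℂ) (n : ℤ), Complex.cosh a = n ∧ ‖a - z‖ < 6 := by
  obtain ⟨t, n, ht, hxt⟩ : ∃ (t : ℝ) (n : ℕ), Real.cosh t = n ∧ |z.re - t| ≤ 2 := by
    rcases le_total 0 z.re with h | h
    · exact exists_cosh_eq_natCast_abs_sub_le h
    · obtain ⟨t, n, ht, hxt⟩ := exists_cosh_eq_natCast_abs_sub_le (neg_nonneg.2 h)
      refine ⟨-t, n, by rwa [Real.cosh_neg], ?_⟩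
      rwa [show z.re - -t = -(-z.re - t) by ring, abs_neg]
  have hpi := Real.pi_pos
  set m : ℤ := round (z.im / (2 * Real.pi)) with hm
  have hround : |z.im - m * (2 * Real.pi)| ≤ Real.pi := by
    have h := abs_sub_round (z.im / (2 * Real.pi))
    rw [← hm] at h
    have : z.im - m * (2 * Real.pi) = (z.im / (2 * Real.pi) - m) * (2 * Real.pi) := by
      field_simp
    rw [this, abs_mul, abs_of_pos (by positivity : 0 < 2 * Real.pi)]
    nlinarith
  refine ⟨t + m * (2 * Real.pi * Complex.I), n, ?_, ?_⟩
  · have : Complex.cosh (t + m * (2 * Real.pi * Complex.I)) = Complex.cosh t := by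
      rw [Complex.cosh, Complex.cosh, neg_add, Complex.exp_add, Complex.exp_add,
        Complex.exp_int_mul_two_pi_mul_I, Complex.exp_neg (_ * _), Complex.exp_int_mul_two_pi_mul_I]
      simp
    rw [this, ← Complex.ofReal_cosh, ht]
    simp
  · refine (Complex.norm_le_abs_re_add_abs_im _).trans_lt ?_
    have h1 : (t + m * (2 * Real.pi * Complex.I) - z).re = -(z.re - t) := by simp
    have h2 : (t + m * (2 * Real.pi * Complex.I) - z).im = -(z.im - m * (2 * Real.pi)) := by simp
    rw [h1, h2, abs_neg, abs_neg]
    linarith [Real.pi_lt_four]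

theorem Complex.sinh_abs_re_le_norm_cosh (z : ℂ) : Real.sinh |z.re| ≤ ‖Complex.cosh z‖ := by
  have key : ∀ w : ℂ, Real.sinh w.re ≤ ‖Complex.cosh w‖ := by
    intro w
    have h := norm_sub_norm_le (Complex.exp w) (-Complex.exp (-w))
    rw [norm_neg, sub_neg_eq_add, Complex.norm_exp, Complex.norm_exp, Complex.neg_re] at h
    rw [Complex.cosh, norm_div, Real.sinh_eq]
    simp only [Complex.norm_ofNat]
    linarith
  rcases abs_choice z.re with h | h
  · rw [h]
    exact key z
  · rw [h, ← Complex.cosh_neg]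
    exact key (-z)

theorem Complex.norm_cosh_le_cosh_re (z : ℂ) : ‖Complex.cosh z‖ ≤ Real.cosh z.re := by
  have h := norm_add_le (Complex.exp z) (Complex.exp (-z))
  rw [Complex.norm_exp, Complex.norm_exp, Complex.neg_re] at h
  rw [Complex.cosh, norm_div, Real.cosh_eq]
  simp only [Complex.norm_ofNat]
  linarith

/-- A **Schottky-type theorem** for functions omitting `0` and `1`. -/
theorem exists_norm_le_of_omits_zero_one : ∃ C : ℝ, 1 ≤ C ∧ ∀ (R : ℝ) (g : ℂ → ℂ), 0 < R →
    DifferentiableOn ℂ g (Metric.ball 0 R) → (∀ z ∈ Metric.ball 0 R, g z ≠ 0) →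
    (∀ z ∈ Metric.ball 0 R, g z ≠ 1) → 1 / 8 ≤ ‖g 0‖ → ‖g 0‖ ≤ 1 →
    ∀ z ∈ Metric.closedBall 0 (R / 2), ‖g z‖ ≤ C := by
  refine ⟨Real.exp (2 * Real.pi * Real.cosh 770), Real.one_le_exp (by positivity), ?_⟩
  intro R g hR hg h0 h1 hlow hup z hz
  have hpi := Real.pi_pos
  obtain ⟨L, hL, hL0, hLe⟩ := exists_exp_eq_of_ne_zero hg h0
  have hmem0 : (0 : ℂ) ∈ Metric.ball (0 : ℂ) R := Metric.mem_ball_self hR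
  have h2pi : (2 * Real.pi * Complex.I : ℂ) ≠ 0 := Complex.two_pi_I_ne_zero
  have hnorm2pi : ‖(2 * Real.pi * Complex.I : ℂ)‖ = 2 * Real.pi := by
    simp [abs_of_pos hpi]
  set F : ℂ → ℂ := fun z => L z / (2 * Real.pi * Complex.I) with hF
  -- Landau's device: F = log g / 2πi omits every integer because g omits 1, and F = cosh H because
  -- F omits ±1.
  have hFd : DifferentiableOn ℂ F (Metric.ball 0 R) := hL.div_const _
  have hFL : ∀ z, L z = F z * (2 * Real.pi * Complex.I) := fun z => by
    rw [hF]; field_simp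
  have hFint : ∀ z ∈ Metric.ball (0 : ℂ) R, ∀ n : ℤ, F z ≠ n := by
    intro z hz n hn
    apply h1 z hz
    rw [← hLe z hz, hFL, hn, Complex.exp_int_mul_two_pi_mul_I]
  obtain ⟨H, hH, hHe⟩ := exists_cosh_eq_of_sq_ne_one hFd (fun z hz h => by
    rcases sq_eq_sq_iff_eq_or_eq_neg.1 (h.trans (one_pow 2).symm) with h | h
    · exact hFint z hz 1 (by simpa using h)
    · exact hFint z hz (-1) (by simpa using h))
  have hF0 : ‖F 0‖ ≤ 2 := by
    have hlog : ‖L 0‖ ≤ 4 * Real.pi := by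
      rw [hL0]
      have hre : |(Complex.log (g 0)).re| ≤ 8 := by
        rw [Complex.log_re, abs_of_nonpos (Real.log_nonpos (norm_nonneg _) hup)]
        have : Real.log (1 / 8) ≤ Real.log ‖g 0‖ := Real.log_le_log (by norm_num) hlow
        rw [one_div, Real.log_inv] at this
        have h8 := Real.log_le_sub_one_of_pos (show (0:ℝ) < 8 by norm_num)
        linarith
      have him : |(Complex.log (g 0)).im| ≤ Real.pi := by
        rw [Complex.log_im]
        exact Complex.abs_arg_le_pi _
      linarith [Complex.norm_le_abs_re_add_abs_im (Complex.log (g 0)), Real.pi_gt_three]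
    rw [hF]
    simp only
    rw [norm_div, hnorm2pi, div_le_iff₀ (by positivity)]
    linarith
  have hH0 : |(H 0).re| ≤ 2 := by
    have h := Complex.sinh_abs_re_le_norm_cosh (H 0)
    rw [hHe 0 hmem0] at h
    linarith [Real.self_le_sinh_iff.2 (abs_nonneg (H 0).re)]
  have hderiv : ∀ z ∈ Metric.closedBall (0 : ℂ) (R / 2), ‖deriv H z‖ ≤ 1536 / R := by
    intro z hz
    have hsub : Metric.ball z (R / 2) ⊆ Metric.ball 0 R := by
      refine Metric.ball_subset_ball' ?_
      rw [Metric.mem_closedBall] at hz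
      linarith
    -- The Bloch radius (R/4)|H'|/64 would exceed 6 as soon as |H'| > 1536/R.
    obtain ⟨w, hw⟩ := exists_ball_subset_image_of_deriv (ρ := R / 4) (by positivity)
      (by linarith) (hH.mono hsub)
    by_contra! hcon
    obtain ⟨a, n, ha, haw⟩ := exists_cosh_eq_intCast_norm_sub_lt w
    rw [div_lt_iff₀ hR] at hcon
    obtain ⟨y, hy, hya⟩ := hw (mem_ball_iff_norm.2 (haw.trans (by linarith)))
    refine hFint y (hsub hy) n ?_
    rw [← hHe y (hsub hy), hya, ha]
  have hcs : Metric.closedBall (0 : ℂ) (R / 2) ⊆ Metric.ball 0 R :=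
    Metric.closedBall_subset_ball (by linarith)
  have hdiff : ‖H z - H 0‖ ≤ 768 := by
    have := (convex_closedBall (0 : ℂ) (R / 2)).norm_image_sub_le_of_norm_deriv_le (𝕜 := ℂ)
      (fun w hw => hH.differentiableAt (Metric.isOpen_ball.mem_nhds (hcs hw))) hderiv
      (Metric.mem_closedBall_self (by positivity)) hz
    rw [mem_closedBall_iff_norm] at hz
    calc _ ≤ _ := this
      _ ≤ 1536 / R * (R / 2) := by gcongr
      _ = 768 := by field_simp; norm_num
  have hre : |(H z).re| ≤ 770 := by
    have h1 := (Complex.abs_re_le_norm (H z - H 0)).trans hdiff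
    rw [Complex.sub_re] at h1
    have h2 := abs_sub_abs_le_abs_sub (H z).re (H 0).re
    linarith
  have hFz : ‖F z‖ ≤ Real.cosh 770 := by
    rw [← hHe z (hcs hz)]
    refine (Complex.norm_cosh_le_cosh_re _).trans (Real.cosh_le_cosh.2 ?_)
    rwa [abs_of_pos (show (0:ℝ) < 770 by norm_num)]
  rw [← hLe z (hcs hz), Complex.norm_exp, Real.exp_le_exp]
  calc (L z).re ≤ ‖L z‖ := Complex.re_le_norm _
    _ = 2 * Real.pi * ‖F z‖ := by rw [hFL, norm_mul, hnorm2pi, mul_comm]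
    _ ≤ _ := by gcongr

/-- **Bohr's theorem**: if a holomorphic function is large somewhere on the half-size disc, then
its image contains a large circle centred at the origin. -/
theorem exists_sphere_subset_image : ∃ C : ℝ, 1 ≤ C ∧ ∀ (R S : ℝ) (g : ℂ → ℂ), 0 < R → 0 < S →
    DifferentiableOn ℂ g (Metric.ball 0 R) → ‖g 0‖ ≤ S / 2 →
    ∀ z ∈ Metric.closedBall 0 (R / 2), C * S < ‖g z‖ →
      ∃ ρ, S ≤ ρ ∧ Metric.sphere 0 ρ ⊆ g '' Metric.ball 0 R := by
  obtain ⟨C, hC1, hC⟩ := exists_norm_le_of_omits_zero_one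
  refine ⟨1 + 4 * C, by linarith, ?_⟩
  intro R S g hR hS hg hg0 z hz hgz
  by_contra! hcon
  -- Omitted values on the circles of radii S and 3S are moved to 0 and 1; then the value at the
  -- origin has modulus between 1/8 and 1.
  obtain ⟨w₁, hw₁, hw₁'⟩ := Set.not_subset.1 (hcon S le_rfl)
  obtain ⟨w₂, hw₂, hw₂'⟩ := Set.not_subset.1 (hcon (3 * S) (by linarith))
  rw [mem_sphere_zero_iff_norm] at hw₁ hw₂
  have hlow : 2 * S ≤ ‖w₂ - w₁‖ := by linarith [norm_sub_norm_le w₂ w₁]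
  have hupp : ‖w₂ - w₁‖ ≤ 4 * S := by linarith [norm_sub_le w₂ w₁]
  have hne : w₂ - w₁ ≠ 0 := norm_pos_iff.1 (by linarith)
  have hpos : 0 < ‖w₂ - w₁‖ := norm_pos_iff.2 hne
  have key := hC R (fun z => (g z - w₁) / (w₂ - w₁)) hR ((hg.sub_const w₁).div_const _)
    (fun z hz h => by
      rw [div_eq_zero_iff, or_iff_left hne, sub_eq_zero] at h
      exact hw₁' ⟨z, hz, h⟩)
    (fun z hz h => by
      rw [div_eq_one_iff_eq hne, sub_left_inj] at h
      exact hw₂' ⟨z, hz, h⟩)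
    (by
      rw [norm_div, le_div_iff₀ hpos]
      have := norm_sub_norm_le w₁ (g 0)
      rw [norm_sub_rev] at this
      linarith)
    (by
      rw [norm_div, div_le_one hpos]
      linarith [norm_sub_le (g 0) w₁])
    z hz
  rw [norm_div, div_le_iff₀ hpos] at key
  have h1 := norm_sub_norm_le (g z) w₁
  have h2 : C * ‖w₂ - w₁‖ ≤ C * (4 * S) := by gcongr
  linarith

/-! ### Growth of the maximum modulus -/

open Filter

section MaxModulus

variable {f : ℂ → ℂ} {r s : ℝ}

theorem norm_le_maxModulus (hf : Continuous f) {z : ℂ} (hz : ‖z‖ = r) : ‖f z‖ ≤ maxModulus f r :=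
  le_csSup ((isCompact_sphere 0 r).image hf.norm).bddAbove ⟨z, mem_sphere_zero_iff_norm.2 hz, rfl⟩

theorem exists_norm_eq_maxModulus (hf : Continuous f) (hr : 0 ≤ r) :
    ∃ z : ℂ, ‖z‖ = r ∧ ‖f z‖ = maxModulus f r := by
  obtain ⟨z, hz, h⟩ := ((isCompact_sphere (0 : ℂ) r).image hf.norm).sSup_mem
    ((NormedSpace.sphere_nonempty.2 hr).image _)
  exact ⟨z, mem_sphere_zero_iff_norm.1 hz, h⟩

theorem maxModulus_le (hf : Continuous f) (hr : 0 ≤ r) {C : ℝ} (h : ∀ z, ‖z‖ = r → ‖f z‖ ≤ C) :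
    maxModulus f r ≤ C := by
  obtain ⟨z, hz, hz'⟩ := exists_norm_eq_maxModulus hf hr
  exact hz' ▸ h z hz

theorem maxModulus_nonneg (hf : Continuous f) (hr : 0 ≤ r) : 0 ≤ maxModulus f r := by
  obtain ⟨z, -, hz'⟩ := exists_norm_eq_maxModulus hf hr
  exact hz' ▸ norm_nonneg _

theorem norm_le_maxModulus_of_norm_le (hf : Differentiable ℂ f) {z : ℂ} (hz : ‖z‖ ≤ r) :
    ‖f z‖ ≤ maxModulus f r := by
  have hr : 0 ≤ r := (norm_nonneg z).trans hz
  rcases hr.eq_or_lt with rfl | hr'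
  · exact norm_le_maxModulus hf.continuous (le_antisymm hz (norm_nonneg z))
  refine Complex.norm_le_of_forall_mem_frontier_norm_le (U := Metric.ball 0 r)
    Metric.isBounded_ball hf.diffContOnCl (fun w hw => ?_) ?_
  · rw [frontier_ball _ hr'.ne', mem_sphere_zero_iff_norm] at hw
    exact norm_le_maxModulus hf.continuous hw
  · rw [closure_ball _ hr'.ne']
    simpa using hz

theorem maxModulus_mono (hf : Differentiable ℂ f) (hr : 0 ≤ r) (hrs : r ≤ s) :
    maxModulus f r ≤ maxModulus f s :=
  maxModulus_le hf.continuous hr fun _ hz => norm_le_maxModulus_of_norm_le hf (hz.trans_le hrs)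

theorem maxModulus_comp_le {g : ℂ → ℂ} (hf : Differentiable ℂ f) (hg : Continuous g)
    (hr : 0 ≤ r) : maxModulus (f ∘ g) r ≤ maxModulus f (maxModulus g r) :=
  maxModulus_le (hf.continuous.comp hg) hr fun _ hz =>
    norm_le_maxModulus_of_norm_le hf (norm_le_maxModulus hg hz)

/-- Cauchy's estimate for f' at a point where it does not vanish. -/
theorem exists_mul_le_maxModulus (hf : Differentiable ℂ f) (hne : ∃ z, deriv f z ≠ 0) :
    ∃ c > 0, ∀ᶠ r in atTop, c * r ≤ maxModulus f r := by
  obtain ⟨z₀, hz₀⟩ := hne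
  have hpos := norm_pos_iff.2 hz₀
  refine ⟨‖deriv f z₀‖ / 2, by positivity, ?_⟩
  filter_upwards [eventually_gt_atTop (2 * ‖z₀‖)] with r hr
  have hn := norm_nonneg z₀
  have hd : 0 < r - ‖z₀‖ := by linarith
  have := Complex.norm_deriv_le_of_forall_mem_sphere_norm_le (C := maxModulus f r) hd
    hf.diffContOnCl (fun z hz => norm_le_maxModulus_of_norm_le hf (by
      rw [mem_sphere_iff_norm] at hz
      linarith [norm_sub_norm_le z z₀]))
  rw [le_div_iff₀ hd] at this
  nlinarith

theorem tendsto_maxModulus_atTop (hf : Differentiable ℂ f) (hne : ∃ z, deriv f z ≠ 0) :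
    Tendsto (maxModulus f) atTop atTop := by
  obtain ⟨c, hc, h⟩ := exists_mul_le_maxModulus hf hne
  exact tendsto_atTop_mono' _ h (tendsto_id.const_mul_atTop hc)

/-- **Hadamard's three circles theorem**, with inner radius one. -/
theorem maxModulus_rpow_le (hf : Differentiable ℂ f) (hr : 1 < r) {K : ℝ} (hK : 1 < K) :
    maxModulus f r ^ K ≤ maxModulus f 1 ^ (K - 1) * maxModulus f (r ^ K) := by
  have hr0 : 0 < r := by linarith
  have hK0 : 0 < K := by linarith
  have hlog : 0 < Real.log r := Real.log_pos hr
  have hu : 0 < K * Real.log r := by positivity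
  have hexp : Real.exp (K * Real.log r) = r ^ K := by
    rw [Real.rpow_def_of_pos hr0, mul_comm]
  have hb0 := maxModulus_nonneg hf.continuous (Real.rpow_nonneg hr0.le K)
  have ha0 := maxModulus_nonneg hf.continuous zero_le_one
  obtain ⟨z, hz, hzM⟩ := exists_norm_eq_maxModulus hf.continuous hr0.le
  have hz0 : z ≠ 0 := norm_pos_iff.1 (hz ▸ hr0)
  have hre : (Complex.log z).re = Real.log r := by rw [Complex.log_re, hz]
  -- Precomposing with exp turns the annulus into a strip, where the three lines theorem applies.
  have hG : Differentiable ℂ fun w => f (Complex.exp w) := hf.comp Complex.differentiable_exp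
  have key := Complex.HadamardThreeLines.norm_le_interp_of_mem_verticalClosedStrip'
    (f := fun w => f (Complex.exp w)) (z := Complex.log z) (a := maxModulus f 1)
    (b := maxModulus f (r ^ K)) hu
    (by
      change (Complex.log z).re ∈ Set.Icc _ _
      rw [hre]
      exact ⟨hlog.le, by nlinarith⟩)
    hG.diffContOnCl
    (by
      refine ⟨maxModulus f (r ^ K), ?_⟩
      rintro _ ⟨w, hw, rfl⟩
      refine norm_le_maxModulus_of_norm_le hf ?_
      rw [Complex.norm_exp, ← hexp, Real.exp_le_exp]
      exact hw.2)
    (fun w hw => norm_le_maxModulus hf.continuous (by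
      rw [Complex.norm_exp, show w.re = 0 from hw, Real.exp_zero]))
    (fun w hw => norm_le_maxModulus hf.continuous (by
      rw [Complex.norm_exp, show w.re = K * Real.log r from hw, hexp]))
  simp only [hre, sub_zero, Complex.exp_log hz0, hzM] at key
  rw [show Real.log r / (K * Real.log r) = 1 / K by field_simp] at key
  calc maxModulus f r ^ K
      ≤ (maxModulus f 1 ^ (1 - 1 / K) * maxModulus f (r ^ K) ^ (1 / K)) ^ K :=
        Real.rpow_le_rpow (maxModulus_nonneg hf.continuous hr0.le) key hK0.le
    _ = _ := by
      rw [Real.mul_rpow (by positivity) (by positivity), ← Real.rpow_mul ha0, ← Real.rpow_mul hb0,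
        one_div_mul_cancel hK0.ne', Real.rpow_one, sub_mul, one_div_mul_cancel hK0.ne', one_mul]

/-- A quantitative lower bound for the maximum modulus of a composition. -/
theorem eventually_maxModulus_le_maxModulus_comp {g : ℂ → ℂ} (hf : Differentiable ℂ f)
    (hg : Differentiable ℂ g) (hne : ∃ z, deriv g z ≠ 0) {k : ℝ} (hk : 1 ≤ k) :
    ∀ᶠ r in atTop, maxModulus f (maxModulus g r ^ k) ≤ maxModulus (f ∘ g) (r ^ (k + 2)) := by
  obtain ⟨C, hC1, hC⟩ := exists_sphere_subset_image
  have ht := tendsto_maxModulus_atTop hg hne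
  filter_upwards [eventually_ge_atTop 2, ht.eventually_ge_atTop 1,
    ht.eventually_ge_atTop (2 * ‖g 0‖), ht.eventually_gt_atTop (C * maxModulus g 1 ^ k)]
    with r hr h1 h2 h3
  have hr0 : 0 < r := by linarith
  have hSM : maxModulus g r ≤ maxModulus g r ^ k := Real.self_le_rpow_of_one_le h1 hk
  have hS0 : 0 < maxModulus g r ^ k := by linarith
  obtain ⟨z, hz, hzM⟩ := exists_norm_eq_maxModulus hg.continuous (Real.rpow_nonneg hr0.le (k + 1))
  -- The extra factor r ≥ 2 puts the circle of radius r^(k+1) inside the half-size disc.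
  have hhalf : r ^ (k + 1) ≤ r ^ (k + 2) / 2 := by
    rw [show k + 2 = k + 1 + 1 by ring, Real.rpow_add_one hr0.ne' (k + 1)]
    nlinarith [Real.rpow_pos_of_pos hr0 (k + 1)]
  -- Hadamard with exponent k + 1 leaves a spare factor M(r,g), which absorbs C · M(1,g)^k.
  have hlarge : C * maxModulus g r ^ k < ‖g z‖ := by
    have h := maxModulus_rpow_le hg (show 1 < r by linarith) (show 1 < k + 1 by linarith)
    rw [add_sub_cancel_right, Real.rpow_add_one (by linarith), ← hzM] at h
    have hA : 0 ≤ maxModulus g 1 ^ k :=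
      Real.rpow_nonneg (maxModulus_nonneg hg.continuous zero_le_one) k
    refine lt_of_mul_lt_mul_left (lt_of_lt_of_le ?_ h) hA
    nlinarith
  obtain ⟨ρ, hρ, hsub⟩ := hC (r ^ (k + 2)) (maxModulus g r ^ k) g (by positivity) hS0
    hg.differentiableOn (by linarith) z (by simpa [hz] using hhalf) hlarge
  refine (maxModulus_mono hf hS0.le hρ).trans (maxModulus_le hf.continuous (hS0.le.trans hρ) ?_)
  intro w hw
  obtain ⟨y, hy, rfl⟩ := hsub (mem_sphere_zero_iff_norm.2 hw)
  exact norm_le_maxModulus_of_norm_le (hf.comp hg) (mem_ball_zero_iff.1 hy).le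

end MaxModulus

/-! ### Strong log-regularity under composition -/

theorem IsTranscendentalEntire.exists_deriv_ne_zero {f : ℂ → ℂ} (hf : IsTranscendentalEntire f) :
    ∃ z, deriv f z ≠ 0 := by
  by_contra! h
  exact hf.2 ⟨Polynomial.C (f 0), fun z => by
    rw [Polynomial.eval_C]
    exact is_const_of_deriv_eq_zero hf.1 h z 0⟩

theorem Polynomial.exists_norm_eval_le (p : Polynomial ℂ) :
    ∃ B > 0, ∀ z : ℂ, 1 ≤ ‖z‖ → ‖p.eval z‖ ≤ B * ‖z‖ ^ p.natDegree := by
  refine ⟨∑ i ∈ Finset.range (p.natDegree + 1), ‖p.coeff i‖ + 1, by positivity, fun z hz => ?_⟩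
  rw [Polynomial.eval_eq_sum_range]
  calc _ ≤ ∑ i ∈ Finset.range (p.natDegree + 1), ‖p.coeff i‖ * ‖z‖ ^ p.natDegree := by
        refine norm_sum_le_of_le _ fun i hi => ?_
        rw [norm_mul, norm_pow]
        gcongr
        exact Nat.lt_succ_iff.1 (Finset.mem_range.1 hi)
    _ ≤ _ := by
        rw [← Finset.sum_mul]
        gcongr
        linarith

/-- For a polynomial the right side is O(log r), whereas the left side is at least (log r / 2)². -/
theorem isTranscendentalEntire_of_log_maxModulus_rpow {h : ℂ → ℂ} (hh : Differentiable ℂ h)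
    (hne : ∃ z, deriv h z ≠ 0) {K : ℝ} (hK : 1 ≤ K)
    (hlog : ∀ᶠ r in atTop, (K * Real.log (maxModulus h r)) ^ (2 : ℕ) ≤
      Real.log (maxModulus h (r ^ K))) : IsTranscendentalEntire h := by
  refine ⟨hh, ?_⟩
  rintro ⟨p, hp⟩
  obtain ⟨B, hB, hpB⟩ := p.exists_norm_eval_le
  obtain ⟨c, hc, hcM⟩ := exists_mul_le_maxModulus hh hne
  have hN : (0 : ℝ) ≤ p.natDegree := Nat.cast_nonneg _
  obtain ⟨r, hr, hcr, hr1, hx1, hx2⟩ := (hlog.and (hcM.and ((eventually_gt_atTop 1).and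
    ((Real.tendsto_log_atTop.eventually_ge_atTop (-2 * Real.log c)).and
    (Real.tendsto_log_atTop.eventually_ge_atTop
      (4 * (|Real.log B| + p.natDegree * K) + 1)))))).exists
  have hr0 : 0 < r := by linarith
  have hrK : 1 ≤ r ^ K := Real.one_le_rpow hr1.le (by linarith)
  have hlow : Real.log c + Real.log r ≤ Real.log (maxModulus h r) := by
    rw [← Real.log_mul hc.ne' hr0.ne']
    exact Real.log_le_log (by positivity) hcr
  have hMpos : 0 < maxModulus h (r ^ K) :=
    (lt_of_lt_of_le (by positivity) hcr).trans_le
      (maxModulus_mono hh hr0.le (Real.self_le_rpow_of_one_le hr1.le hK))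
  have hup : Real.log (maxModulus h (r ^ K)) ≤ Real.log B + p.natDegree * (K * Real.log r) := by
    rw [← Real.log_rpow hr0, ← Real.log_pow, ← Real.log_mul hB.ne' (by positivity)]
    refine Real.log_le_log hMpos (maxModulus_le hh.continuous (by linarith) fun z hz => ?_)
    rw [hp, ← hz]
    exact hpB z (hz ▸ hrK)
  have hx0 : 1 ≤ Real.log r := by nlinarith [abs_nonneg (Real.log B), mul_nonneg hN (by linarith : 0 ≤ K)]
  have hsq : (Real.log r / 2) ^ 2 ≤ (K * Real.log (maxModulus h r)) ^ 2 := by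
    gcongr
    nlinarith
  have hBle := le_abs_self (Real.log B)
  have hBx : |Real.log B| ≤ |Real.log B| * Real.log r :=
    le_mul_of_one_le_right (abs_nonneg _) hx0
  nlinarith

theorem IsStronglyLogRegular.comp {f g : ℂ → ℂ} (hf : IsStronglyLogRegular f)
    (hg : IsTranscendentalEntire g) : IsStronglyLogRegular (f ∘ g) := by
  obtain ⟨hft, hf⟩ := hf
  have hh : Differentiable ℂ (f ∘ g) := hft.1.comp hg.1
  have htf := tendsto_maxModulus_atTop hft.1 hft.exists_deriv_ne_zero
  have htg := tendsto_maxModulus_atTop hg.1 hg.exists_deriv_ne_zero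
  have hne : ∃ z, deriv (f ∘ g) z ≠ 0 := by
    by_contra! hcon
    -- The case k = 1 of the lower bound makes M(r³, f∘g) unbounded, so f∘g is not constant.
    obtain ⟨r, hr0, hr, hr1, hr2⟩ := ((eventually_ge_atTop 0).and
      ((eventually_maxModulus_le_maxModulus_comp hft.1 hg.1 hg.exists_deriv_ne_zero le_rfl).and
      ((htg.eventually_ge_atTop 0).and
      ((htf.comp htg).eventually_gt_atTop ‖(f ∘ g) 0‖)))).exists
    rw [Real.rpow_one] at hr
    have := maxModulus_le hh.continuous (Real.rpow_nonneg hr0 (1 + 2)) (C := ‖(f ∘ g) 0‖)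
      fun z _ => by rw [is_const_of_deriv_eq_zero hh hcon z 0]
    exact absurd (hr.trans this) (not_le.2 hr2)
  have hth := tendsto_maxModulus_atTop hh hne
  have key : ∀ ε : ℝ, 0 < ε → ε < 1 → ∃ K, 1 < K ∧ ∀ᶠ r in atTop,
      (K * Real.log (maxModulus (f ∘ g) r)) ^ (1 / ε) ≤
        Real.log (maxModulus (f ∘ g) (r ^ K)) := by
    intro ε hε hε1
    -- Using ε/2 yields (X²)^(1/ε), and X² ≥ (k + 2)X once X ≥ k + 2; this pays for the larger
    -- exponent k + 2.
    obtain ⟨R, k, -, hk, hfk⟩ := hf (ε / 2) (by linarith) (by linarith)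
    refine ⟨k + 2, by linarith, ?_⟩
    filter_upwards [eventually_ge_atTop 0, htg.eventually_gt_atTop R, htg.eventually_ge_atTop 1,
      (htf.comp htg).eventually_ge_atTop 1, hth.eventually_ge_atTop 1,
      ((Real.tendsto_log_atTop.comp htf).comp htg).eventually_ge_atTop (k + 2),
      eventually_maxModulus_le_maxModulus_comp hft.1 hg.1 hg.exists_deriv_ne_zero hk.le]
      with r hr0 hR hg1 hf1 hh1 hX hlow
    simp only [Function.comp_apply] at hf1 hX
    set s := maxModulus g r
    set X := Real.log (maxModulus f s)
    have hL0 : 0 ≤ Real.log (maxModulus (f ∘ g) r) := Real.log_nonneg hh1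
    have hLX : Real.log (maxModulus (f ∘ g) r) ≤ X :=
      Real.log_le_log (by linarith) (maxModulus_comp_le hft.1 hg.1.continuous hr0)
    have hX0 : 0 ≤ X := by linarith
    have hMk : 0 < maxModulus f (s ^ k) := by
      linarith [maxModulus_mono hft.1 (by linarith) (Real.self_le_rpow_of_one_le hg1 hk.le)]
    calc ((k + 2) * Real.log (maxModulus (f ∘ g) r)) ^ (1 / ε)
        ≤ (X ^ (2 : ℝ)) ^ (1 / ε) := by
          refine Real.rpow_le_rpow (mul_nonneg (by linarith) hL0) ?_ (by positivity)
          rw [Real.rpow_two, sq]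
          exact mul_le_mul hX hLX hL0 hX0
      _ = X ^ (1 / (ε / 2)) := by
          rw [← Real.rpow_mul hX0]
          congr 1
          field_simp
      _ ≤ (k * X) ^ (1 / (ε / 2)) :=
          Real.rpow_le_rpow hX0 (le_mul_of_one_le_left hX0 hk.le) (by positivity)
      _ ≤ Real.log (maxModulus f (s ^ k)) := hfk s hR
      _ ≤ _ := Real.log_le_log hMk hlow
  refine ⟨?_, fun ε hε hε1 => ?_⟩
  -- ε = 1/2 gives the exponent 2 needed to exclude polynomials.
  · obtain ⟨K, hK, hlog⟩ := key (1 / 2) (by norm_num) (by norm_num)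
    refine isTranscendentalEntire_of_log_maxModulus_rpow hh hne hK.le ?_
    filter_upwards [hlog] with r hr
    rwa [one_div_one_div, Real.rpow_two] at hr
  · obtain ⟨K, hK, hlog⟩ := key ε hε hε1
    obtain ⟨R, hR⟩ := eventually_atTop.1 hlog
    exact ⟨max R 1, K, by positivity, hK, fun r hr => hR r ((le_max_left _ _).trans hr.le)⟩

/-- Reassociating to the left keeps the outer factor strongly log-regular, so each inner factor need
only be transcendental. -/
theorem IsStronglyLogRegular.comp_foldr {f : ℂ → ℂ} (hf : IsStronglyLogRegular f)
    (l : List (ℂ → ℂ)) (hl : ∀ g ∈ l, IsTranscendentalEntire g) :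
    IsStronglyLogRegular (f ∘ l.foldr (fun g h => g ∘ h) id) := by
  induction l generalizing f with
  | nil => exact hf
  | cons g l ih =>
    rw [List.foldr_cons, ← Function.comp_assoc]
    exact ih (hf.comp (hl g List.mem_cons_self)) fun u hu => hl u (List.mem_cons_of_mem _ hu)

theorem theorem3p1 :
    (∀ (j : ℕ) (hj : 0 < j) (f : Fin j → ℂ → ℂ), (∀ i, IsTranscendentalEntire (f i)) →
      IsStronglyLogRegular (f ⟨0, hj⟩) → IsStronglyLogRegular (finComp f)) ∧
    (∀ f : ℂ → ℂ, IsStronglyLogRegular f → ∀ n : ℕ, 1 ≤ n → IsStronglyLogRegular (f^[n])) := by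
  constructor
  · intro j hj f hf h0
    obtain ⟨m, rfl⟩ := Nat.exists_eq_succ_of_ne_zero hj.ne'
    rw [finComp, List.ofFn_succ, List.foldr_cons]
    refine IsStronglyLogRegular.comp_foldr h0 _ fun g hg => ?_
    obtain ⟨i, rfl⟩ := List.mem_ofFn.1 hg
    exact hf _
  · intro f hf n hn
    induction n, hn using Nat.le_induction with
    | base => exact hf
    | succ n _ ih =>
      rw [Function.iterate_succ]
      exact ih.comp hf.1
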